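/- Let $\alpha\in(0,1)$, $1<p<\frac1{1-\alpha}$, $T>0$, $K\ge 0$, $\nu>0$, and let $N>1$, $d\ge1$ be integers. Let $a_{ij}\ge0$ and $c_i\ge0$ ($i,j=1,\dots,N$) be constants and $x_{00},x_{10},\dots,x_{N0}\in\mathbb R^d$. Write $\|\cdot\|$ for the Euclidean norm on $\mathbb R^d$. For $\beta>0$ and an integrable $f$ on $[0,T]$ let $$I^{\beta}_{0+}[f](t)=\frac1{\Gamma(\beta)}\int_0^t\frac{f(\tau)}{(t-\tau)^{1-\beta}}\,d\tau\quad\text{for a.e. }t\in[0,T],$$ and, when $I^{1-\alpha}_{0+}[f]$ has an absolutely continuous representative on $[0,T]$, let $D^{\alpha}_{0+}[f]=\frac{d}{dt}I^{1-\alpha}_{0+}[f]$ be the Riemann–Liouville derivative, with $I^{1-\alpha}_{0+}[f](0)$ the value of that representative at $0$. Let $$\mathcal U_M=\{u\in L^1([0,T];\mathbb R^d):\ \|u(t)\|\le K,\ t\in[0,T]\}.$$ Call $(x,u)$ admissible if $u\in\mathcal U_M$ and $x=(x_0,x_1,\dots,x_N)\in L^1([0,T];(\mathbb R^d)^{N+1})$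 is such that $I^{1-\alpha}_{0+}[x]$ has an absolutely continuous representative on $[0,T]$ and, for a.e. $t\in[0,T]$ and $i=1,\dots,N$, $$D^\alpha_{0+}[x_0](t)=u(t),\qquad D^\alpha_{0+}[x_i](t)=\sum_{j=1}^N a_{ij}\,(x_j(t)-x_i(t))+c_i\,(x_0(t)-x_i(t)),$$ with $I^{1-\alpha}_{0+}[x_j](0)=x_{j0}$ for $j=0,1,\dots,N$. Then there is an admissible pair $(x_*,u_*)$ that minimizes the cost $$J(x,u)=\int_0^T\Bigl[\frac1{2N^2}\sum_{i,j=1}^N\|x_i(t)-x_j(t)\|^2+\frac12\sum_{i=1}^N\|x_0(t)-x_i(t)\|^2+\frac\nu2\|u(t)\|^2\Bigr]dt\in[0,\infty]$$ over all admissible pairs $(x,u)$, and it satisfies $$(x_*,u_*)\in\Bigl(I^\alpha_{0+}\bigl(L^p([0,T];(\mathbb R^d)^{N+1})\bigr)+\Bigl\{\frac{c}{t^{1-\alpha}}:\ c\in(\mathbb R^d)^{N+1}\Bigr\}\Bigr)\times\mathcal U_M .$$ -/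

import Mathlib

open MeasureTheory Set

noncomputable section

/-- The left Riemann–Liouville fractional integral of order `α` with lower limit `0`,
`I^α_{0+}[f](t) = (1 / Γ(α)) ∫_0^t f(τ) / (t - τ)^{1-α} dτ`. -/
def rlIntegral {E : Type*} [NormedAddCommGroup E] [NormedSpace ℝ E]
    (α : ℝ) (f : ℝ → E) (t : ℝ) : E :=
  (1 / Real.Gamma α) • ∫ τ in (0 : ℝ)..t, (1 / (t - τ) ^ (1 - α)) • f τ

/-- `f ∈ L¹([0,T])` has left Riemann–Liouville derivative `D^α_{0+}[f] = v` a.e. on `[0,T]`, with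
initial value `I^{1-α}_{0+}[f](0) = y₀`. The function `I^{1-α}_{0+}[f]` is defined almost everywhere;
it is required to have an absolutely continuous representative `F` on `[0,T]`, and the derivative
and the value at `0` are those of `F`. -/
def HasRLDerivWithInit {E : Type*} [NormedAddCommGroup E] [NormedSpace ℝ E]
    (α T : ℝ) (f v : ℝ → E) (y₀ : E) : Prop :=
  IntegrableOn f (Icc 0 T) ∧
    ∃ F : ℝ → E, AbsolutelyContinuousOnInterval F 0 T ∧
      (∀ᵐ t ∂volume.restrict (Icc 0 T), F t = rlIntegral (1 - α) f t) ∧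
      (∀ᵐ t ∂volume.restrict (Icc 0 T), HasDerivAt F (v t) t) ∧
      F 0 = y₀

/-- Membership (up to a null set) in
`I^α_{0+}(L^p([0,T]; E)) + {c / t^{1-α} : c ∈ E}`. -/
def MemRLSpace {E : Type*} [NormedAddCommGroup E] [NormedSpace ℝ E]
    (α p T : ℝ) (x : ℝ → E) : Prop :=
  ∃ g : ℝ → E, MemLp g (ENNReal.ofReal p) (volume.restrict (Icc 0 T)) ∧
    ∃ c : E, ∀ᵐ t ∂volume.restrict (Icc 0 T),
      x t = rlIntegral α g t + (1 / t ^ (1 - α)) • c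

namespace HegselmannKrause

/-- Opinions of the leader (index `0`) and of the `N` agents (indices `1, …, N`) in `ℝ^d`. -/
abbrev State (N d : ℕ) : Type := Fin (N + 1) → EuclideanSpace ℝ (Fin d)

/-- The right-hand side of the controlled system: `u` for the leader and
`∑_j a_{ij} (x_j - x_i) + c_i (x_0 - x_i)` for the `i`-th agent. -/
def field {N d : ℕ} (a : Fin N → Fin N → ℝ) (c : Fin N → ℝ)
    (x : State N d) (u : EuclideanSpace ℝ (Fin d)) : State N d :=
  Fin.cons u fun i : Fin N =>
    (∑ j : Fin N, a i j • (x j.succ - x i.succ)) + c i • (x 0 - x i.succ)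

/-- The running cost. -/
def runningCost {N d : ℕ} (ν : ℝ) (x : State N d) (u : EuclideanSpace ℝ (Fin d)) : ℝ :=
  1 / (2 * (N : ℝ) ^ 2) * ∑ i : Fin N, ∑ j : Fin N, ‖x i.succ - x j.succ‖ ^ 2
    + 1 / 2 * ∑ i : Fin N, ‖x 0 - x i.succ‖ ^ 2
    + ν / 2 * ‖u‖ ^ 2

/-- The cost functional. The running cost is nonnegative, so its integral over `[0,T]` is a
Lebesgue integral with values in `[0,∞]`. -/
def cost {N d : ℕ} (ν T : ℝ) (x : ℝ → State N d) (u : ℝ → EuclideanSpace ℝ (Fin d)) : ENNReal :=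
  ∫⁻ t in Icc 0 T, ENNReal.ofReal (runningCost ν (x t) (u t))

/-- The set `𝒰_M` of integrable controls on `[0,T]` with values in the closed ball of radius `K`. -/
def controls (d : ℕ) (K T : ℝ) : Set (ℝ → EuclideanSpace ℝ (Fin d)) :=
  {u | IntegrableOn u (Icc 0 T) ∧ ∀ t ∈ Icc 0 T, ‖u t‖ ≤ K}

/-- The pair `(x, u)` is admissible: `u ∈ 𝒰_M`, and `x` solves the system driven by `u` with
`I^{1-α}_{0+}[x](0) = x₀`. -/
def IsAdmissible {N d : ℕ} (α K T : ℝ) (a : Fin N → Fin N → ℝ) (c : Fin N → ℝ) (x₀ : State N d)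
    (x : ℝ → State N d) (u : ℝ → EuclideanSpace ℝ (Fin d)) : Prop :=
  u ∈ controls d K T ∧ HasRLDerivWithInit α T x (fun t => field a c (x t) (u t)) x₀

end HegselmannKrause

end

/-!
Since `I^{1-α}` composed with `I^α` is integration, the initial value problem
`D^α[x] = A x + B u`, `I^{1-α}[x](0) = x₀` is equivalent to the Volterra equation
`x = I^α[A x + B u] + t^{α-1} x₀ / Γ(α)`. In the exponentially weighted (Bielecki) norm
`∫ e^{-st} ‖f(t)‖ dt` the operator `I^α` has norm at most `s^{-α}`, because `s^{-α}` is the mass of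
its damped kernel. Hence `1 - I^α A` is invertible on `L¹`, and the trajectory is a continuous
affine function of the control.

The running cost is continuous and convex, and uniformly convex in the control. So the cost, as a
function of the control alone, is lower semicontinuous on `L¹` by Fatou's lemma, and controls with
nearly minimal cost are close to each other: a minimizing sequence is Cauchy and its limit is
optimal.

The kernel of `I^α` lies in `L^p` exactly when `p (1 - α) < 1`, so Young's inequality makes every
trajectory an `L^p` function; the Volterra equation is then the asserted representation.
-/

open Filter Real AbsolutelyContinuousOnInterval
open ContinuousLinearMap (lsmul)
open scoped Topology ENNReal Convolution

section AbsolutelyContinuous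

variable {E : Type*} [NormedAddCommGroup E] [NormedSpace ℝ E] {a b : ℝ}

theorem absolutelyContinuousOnInterval_primitive {f : ℝ → E} {c : ℝ}
    (hf : IntervalIntegrable f volume a b) (hc : c ∈ uIcc a b) :
    AbsolutelyContinuousOnInterval (fun x ↦ ∫ t in c..x, f t) a b := by
  have hnorm := hf.norm.absolutelyContinuousOnInterval_intervalIntegral hc
  refine squeeze_zero' (.of_forall fun I ↦ Finset.sum_nonneg fun _ _ ↦ dist_nonneg) ?_ hnorm
  filter_upwards [mem_inf_of_right (mem_principal_self (disjWithin a b))] with ⟨n, I⟩ hI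
  refine Finset.sum_le_sum fun i hi ↦ ?_
  obtain ⟨h₁, h₂⟩ := hI.1 i hi
  have hint : ∀ x ∈ uIcc a b, IntervalIntegrable f volume c x := fun x hx ↦
    hf.mono_set (uIcc_subset_uIcc hc hx)
  rw [dist_eq_norm, Real.dist_eq,
    intervalIntegral.integral_interval_sub_left (hint _ h₁) (hint _ h₂),
    intervalIntegral.integral_interval_sub_left (hint _ h₁).norm (hint _ h₂).norm]
  exact intervalIntegral.norm_integral_le_abs_integral_norm

theorem eq_add_integral_of_absolutelyContinuousOnInterval [CompleteSpace E] {F v : ℝ → E}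
    (hF : AbsolutelyContinuousOnInterval F a b) (hv : IntervalIntegrable v volume a b)
    (hd : ∀ᵐ x, x ∈ uIcc a b → HasDerivAt F (v x) x) {x : ℝ} (hx : x ∈ uIcc a b) :
    F x = F a + ∫ t in a..x, v t := by
  have hac := hF.sub (absolutelyContinuousOnInterval_primitive (c := a) hv left_mem_uIcc)
  obtain ⟨C, hC⟩ := hac.const_of_ae_hasDerivAt_zero (by
    filter_upwards [hd, hv.ae_hasDerivAt_integral] with y hFy hvy hy
    simpa only [sub_self] using (hFy hy).sub (hvy hy a left_mem_uIcc))
  have hxa := (hC x hx).trans (hC a left_mem_uIcc).symm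
  simp only [Pi.sub_apply, intervalIntegral.integral_same, sub_zero] at hxa
  exact sub_eq_iff_eq_add.1 hxa

theorem ae_eq_zero_of_primitive_ae_eq_zero [CompleteSpace E] {f : ℝ → E} (hab : a < b)
    (hf : IntegrableOn f (Icc a b))
    (h : (fun t ↦ ∫ τ in a..t, f τ) =ᵐ[volume.restrict (Icc a b)] 0) :
    f =ᵐ[volume.restrict (Icc a b)] 0 := by
  have hi : IntervalIntegrable f volume a b :=
    (intervalIntegrable_iff_integrableOn_Icc_of_le hab.le).2 hf
  have heq : EqOn (fun t ↦ ∫ τ in a..t, f τ) 0 (Icc a b) := by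
    refine Measure.eqOn_Icc_of_ae_eq volume hab.ne h ?_ continuousOn_const
    simpa only [uIcc_of_le hab.le] using intervalIntegral.continuousOn_primitive_interval
      (μ := volume) (f := f) (a := a) (b := b) (by rwa [uIcc_of_le hab.le])
  rw [← restrict_Ioo_eq_restrict_Icc, EventuallyEq, ae_restrict_iff' measurableSet_Ioo]
  filter_upwards [hi.ae_hasDerivAt_integral] with t hd ht
  rw [uIcc_of_le hab.le] at hd
  exact (hd (Ioo_subset_Icc_self ht) a ⟨le_rfl, hab.le⟩).unique
    ((hasDerivAt_const t (0 : E)).congr_of_eventuallyEq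
      (heq.eventuallyEq_of_mem (Icc_mem_nhds ht.1 ht.2)))

end AbsolutelyContinuous

section Kernel

theorem integral_rpow_mul_sub_rpow {u v a : ℝ} (hu : 0 < u) (hv : 0 < v) (ha : 0 < a) :
    ∫ x in (0 : ℝ)..a, x ^ (u - 1) * (a - x) ^ (v - 1) =
      a ^ (u + v - 1) * (Gamma u * Gamma v / Gamma (u + v)) := by
  have hbeta : Complex.betaIntegral u v = ((Gamma u * Gamma v / Gamma (u + v) : ℝ) : ℂ) := by
    have h := Complex.Gamma_mul_Gamma_eq_betaIntegral (s := (u : ℂ)) (t := (v : ℂ))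
      (by simpa) (by simpa)
    rw [← Complex.ofReal_add, Complex.Gamma_ofReal, Complex.Gamma_ofReal,
      Complex.Gamma_ofReal] at h
    rw [Complex.ofReal_div, Complex.ofReal_mul, h, mul_div_cancel_left₀]
    exact Complex.ofReal_ne_zero.2 (Gamma_pos_of_pos (add_pos hu hv)).ne'
  have hscaled := Complex.betaIntegral_scaled (u : ℂ) (v : ℂ) ha
  rw [hbeta] at hscaled
  rw [← Complex.ofReal_inj, ← intervalIntegral.integral_ofReal, Complex.ofReal_mul,
    Complex.ofReal_cpow ha.le]
  push_cast at hscaled ⊢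
  rw [← hscaled]
  refine intervalIntegral.integral_congr fun x hx ↦ ?_
  rw [uIcc_of_le ha.le] at hx
  simp [Complex.ofReal_cpow hx.1, Complex.ofReal_cpow (sub_nonneg.2 hx.2)]

/-- The Riemann–Liouville kernel `t ^ (β - 1) / Γ(β)` of order `β`, damped by the factor
`exp (-s t)` and extended by zero to `t ≤ 0`. For `β, s > 0` it is integrable on `ℝ`. -/
noncomputable def rlKernel (β s : ℝ) : ℝ → ℝ :=
  indicator (Ioi 0) fun t ↦ (1 / Gamma β) * (t ^ (β - 1) * exp (-(s * t)))

variable {β γ s t : ℝ}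

theorem rlKernel_of_pos (ht : 0 < t) :
    rlKernel β s t = (1 / Gamma β) * (t ^ (β - 1) * exp (-(s * t))) :=
  indicator_of_mem (mem_Ioi.2 ht) _

theorem rlKernel_of_nonpos (ht : t ≤ 0) : rlKernel β s t = 0 :=
  indicator_of_notMem (notMem_Ioi.2 ht) _

theorem rlKernel_nonneg (hβ : 0 < β) (s t : ℝ) : 0 ≤ rlKernel β s t :=
  indicator_nonneg (fun t (ht : 0 < t) ↦ by positivity) t

theorem measurable_rlKernel (β s : ℝ) : Measurable (rlKernel β s) :=
  Measurable.indicator (by fun_prop) measurableSet_Ioi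

theorem integral_rlKernel (hβ : 0 < β) (hs : 0 < s) : ∫ t, rlKernel β s t = (1 / s) ^ β := by
  rw [rlKernel, integral_indicator measurableSet_Ioi, integral_const_mul,
    integral_rpow_mul_exp_neg_mul_Ioi hβ hs]
  have := (Gamma_pos_of_pos hβ).ne'
  field_simp

theorem integrable_rlKernel (hβ : 0 < β) (hs : 0 < s) : Integrable (rlKernel β s) := by
  refine Integrable.of_integral_ne_zero ?_
  rw [integral_rlKernel hβ hs]
  positivity

theorem rlKernel_rpow {p : ℝ} (hβ : 0 < β) (hp : 0 < p) (hpβ : p * (1 - β) < 1) :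
    rlKernel β s t ^ p = (1 / Gamma β) ^ p * Gamma (p * (β - 1) + 1) *
      rlKernel (p * (β - 1) + 1) (p * s) t := by
  rcases le_or_gt t 0 with ht | ht
  · rw [rlKernel_of_nonpos ht, rlKernel_of_nonpos ht, zero_rpow hp.ne', mul_zero]
  · have hΓ : Gamma (p * (β - 1) + 1) ≠ 0 := (Gamma_pos_of_pos (by linarith)).ne'
    rw [rlKernel_of_pos ht, rlKernel_of_pos ht, mul_rpow (by positivity) (by positivity),
      mul_rpow (by positivity) (by positivity), ← rpow_mul ht.le, ← exp_mul,
      show (β - 1) * p = p * (β - 1) + 1 - 1 by ring, show -(s * t) * p = -(p * s * t) by ring]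
    field_simp

theorem memLp_rlKernel {p : ℝ} (hβ : 0 < β) (hs : 0 < s) (hp : 0 < p) (hpβ : p * (1 - β) < 1) :
    MemLp (rlKernel β s) (ENNReal.ofReal p) := by
  rw [← integrable_norm_rpow_iff (measurable_rlKernel β s).aestronglyMeasurable
    (ENNReal.ofReal_pos.2 hp).ne' ENNReal.ofReal_ne_top, ENNReal.toReal_ofReal hp.le]
  simp only [norm_of_nonneg (rlKernel_nonneg hβ s _), rlKernel_rpow hβ hp hpβ]
  exact (integrable_rlKernel (by linarith) (mul_pos hp hs)).const_mul _

theorem rlKernel_convolution_rlKernel (hβ : 0 < β) (hγ : 0 < γ) :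
    rlKernel β s ⋆[lsmul ℝ ℝ] rlKernel γ s = rlKernel (β + γ) s := by
  rw [rlKernel, rlKernel, ← posConvolution_eq_convolution_indicator _ _ _ volume, posConvolution,
    rlKernel]
  refine indicator_congr fun x (hx : 0 < x) ↦ ?_
  have hΓβ := (Gamma_pos_of_pos hβ).ne'
  have hΓγ := (Gamma_pos_of_pos hγ).ne'
  calc _ = ∫ t in (0 : ℝ)..x, exp (-(s * x)) * (1 / (Gamma β * Gamma γ)) *
        (t ^ (β - 1) * (x - t) ^ (γ - 1)) := by
        refine intervalIntegral.integral_congr fun t _ ↦ ?_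
        have hexp : exp (-(s * x)) = exp (-(s * t)) * exp (-(s * (x - t))) := by
          rw [← exp_add]; ring_nf
        simp only [ContinuousLinearMap.lsmul_apply, smul_eq_mul, hexp]
        field_simp
    _ = _ := by
      rw [intervalIntegral.integral_const_mul, integral_rpow_mul_sub_rpow hβ hγ hx]
      field_simp

theorem rlKernel_convolution_congr {E : Type*} [NormedAddCommGroup E] [NormedSpace ℝ E]
    {f g : ℝ → E} (h : ∀ τ ≤ t, f τ = g τ) :
    (rlKernel β s ⋆[lsmul ℝ ℝ] f) t = (rlKernel β s ⋆[lsmul ℝ ℝ] g) t := by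
  simp only [convolution_eq_swap, ContinuousLinearMap.lsmul_apply]
  refine integral_congr_ae (.of_forall fun τ ↦ ?_)
  rcases le_total τ t with hτ | hτ
  · simp only [h τ hτ]
  · simp only [rlKernel_of_nonpos (sub_nonpos.2 hτ), zero_smul]

end Kernel

section Young

theorem lintegral_mul_rpow_le {α : Type*} [MeasurableSpace α] {μ : Measure α} {p : ℝ} (hp : 1 ≤ p)
    {F w : α → ℝ≥0∞} (hF : AEMeasurable F μ) (hw : AEMeasurable w μ) :
    (∫⁻ a, F a * w a ∂μ) ^ p ≤ (∫⁻ a, F a ^ p * w a ∂μ) * (∫⁻ a, w a ∂μ) ^ (p - 1) := by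
  have hp₀ : 0 < p := by linarith
  have hp' : 0 ≤ 1 - 1 / p := sub_nonneg.2 ((div_le_one hp₀).2 hp)
  have hsplit : ∀ a, F a * w a = (F a ^ p * w a) ^ (1 / p) * w a ^ (1 - 1 / p) := fun a ↦ by
    rw [ENNReal.mul_rpow_of_nonneg _ _ (by positivity), ← ENNReal.rpow_mul,
      mul_one_div_cancel hp₀.ne', ENNReal.rpow_one, mul_assoc,
      ← ENNReal.rpow_add_of_nonneg _ _ (by positivity) hp', add_sub_cancel, ENNReal.rpow_one]
  have hholder := ENNReal.lintegral_mul_norm_pow_le ((hF.pow_const p).mul hw) hw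
    (by positivity) hp' (add_sub_cancel (1 / p) 1)
  simp only [Pi.mul_apply, ← hsplit] at hholder
  refine (ENNReal.rpow_le_rpow hholder hp₀.le).trans_eq ?_
  rw [ENNReal.mul_rpow_of_nonneg _ _ hp₀.le, ← ENNReal.rpow_mul, ← ENNReal.rpow_mul,
    one_div_mul_cancel hp₀.ne', ENNReal.rpow_one, sub_mul, one_mul, one_div_mul_cancel hp₀.ne']

variable {G E E' F : Type*} [AddCommGroup G] [MeasurableSpace G] [MeasurableAdd₂ G]
  [MeasurableNeg G] {μ : Measure G} [μ.IsAddLeftInvariant] [μ.IsNegInvariant]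
  [NormedAddCommGroup E] [NormedSpace ℝ E] [NormedAddCommGroup E'] [NormedSpace ℝ E']
  [NormedAddCommGroup F] [NormedSpace ℝ F] {f : G → E} {g : G → E'} {p : ℝ}

theorem enorm_convolution_le (L : E →L[ℝ] E' →L[ℝ] F) (t : G) :
    ‖(f ⋆[L, μ] g) t‖ₑ ≤ ‖L‖ₑ * ∫⁻ τ, ‖f (t - τ)‖ₑ * ‖g τ‖ₑ ∂μ := by
  rw [convolution_eq_swap, ← lintegral_const_mul' _ _ enorm_ne_top]
  refine (enorm_integral_le_lintegral_enorm _).trans (lintegral_mono fun τ ↦ ?_)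
  rw [← mul_assoc]
  exact (ContinuousLinearMap.le_opENorm _ _).trans
    (mul_le_mul_left (ContinuousLinearMap.le_opENorm _ _) _)

variable [SFinite μ]

theorem lintegral_enorm_convolution_rpow_le (hp : 1 ≤ p) (hf : AEStronglyMeasurable f μ)
    (hg : AEStronglyMeasurable g μ) (L : E →L[ℝ] E' →L[ℝ] F) :
    ∫⁻ t, ‖(f ⋆[L, μ] g) t‖ₑ ^ p ∂μ ≤
      ‖L‖ₑ ^ p * ((∫⁻ t, ‖f t‖ₑ ^ p ∂μ) * (∫⁻ t, ‖g t‖ₑ ∂μ) ^ p) := by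
  have hp₀ : 0 ≤ p := zero_le_one.trans hp
  have hf_sub : ∀ t, AEMeasurable (fun τ ↦ ‖f (t - τ)‖ₑ) μ := fun t ↦
    (hf.comp_quasiMeasurePreserving
      (quasiMeasurePreserving_sub_left_of_right_invariant μ t)).enorm
  have hjoint : AEMeasurable (Function.uncurry fun t τ ↦ ‖f (t - τ)‖ₑ ^ p * ‖g τ‖ₑ) (μ.prod μ) :=
    ((hf.comp_quasiMeasurePreserving
      (quasiMeasurePreserving_sub_of_right_invariant μ μ)).enorm.pow_const p).mul
        hg.comp_snd.enorm
  calc ∫⁻ t, ‖(f ⋆[L, μ] g) t‖ₑ ^ p ∂μ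
      ≤ ∫⁻ t, ‖L‖ₑ ^ p * ((∫⁻ τ, ‖f (t - τ)‖ₑ ^ p * ‖g τ‖ₑ ∂μ) *
          (∫⁻ τ, ‖g τ‖ₑ ∂μ) ^ (p - 1)) ∂μ := by
        refine lintegral_mono fun t ↦
          (ENNReal.rpow_le_rpow (enorm_convolution_le L t) hp₀).trans ?_
        rw [ENNReal.mul_rpow_of_nonneg _ _ hp₀]
        gcongr
        exact lintegral_mul_rpow_le hp (hf_sub t) hg.enorm
    _ = ‖L‖ₑ ^ p * ((∫⁻ τ, (∫⁻ t, ‖f (t - τ)‖ₑ ^ p ∂μ) * ‖g τ‖ₑ ∂μ) *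
          (∫⁻ τ, ‖g τ‖ₑ ∂μ) ^ (p - 1)) := by
        rw [lintegral_const_mul' _ _ (ENNReal.rpow_ne_top_of_nonneg hp₀ enorm_ne_top),
          lintegral_mul_const'' (f := fun t ↦ ∫⁻ τ, ‖f (t - τ)‖ₑ ^ p * ‖g τ‖ₑ ∂μ) _
            hjoint.lintegral_prod_right', lintegral_lintegral_swap hjoint]
        simp only [lintegral_mul_const' _ _ enorm_ne_top]
    _ = ‖L‖ₑ ^ p * ((∫⁻ t, ‖f t‖ₑ ^ p ∂μ) * (∫⁻ t, ‖g t‖ₑ ∂μ) ^ p) := by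
        simp only [lintegral_sub_right_eq_self (fun t ↦ ‖f t‖ₑ ^ p)]
        rw [lintegral_const_mul'' _ hg.enorm, mul_assoc]
        nth_rewrite 1 [← ENNReal.rpow_one (∫⁻ t, ‖g t‖ₑ ∂μ)]
        rw [← ENNReal.rpow_add_of_nonneg _ _ zero_le_one (sub_nonneg.2 hp), add_sub_cancel]

theorem memLp_convolution (hp : 1 ≤ p) (hf : MemLp f (ENNReal.ofReal p) μ)
    (hg : Integrable g μ) (L : E →L[ℝ] E' →L[ℝ] F) :
    MemLp (f ⋆[L, μ] g) (ENNReal.ofReal p) μ := by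
  have hp₀ : 0 < p := by linarith
  have hp_ne : ENNReal.ofReal p ≠ 0 := (ENNReal.ofReal_pos.2 hp₀).ne'
  have hf_fin := lintegral_rpow_enorm_lt_top_of_eLpNorm_lt_top hp_ne ENNReal.ofReal_ne_top hf.2
  refine ⟨(hf.1.convolution_integrand L hg.1).integral_prod_right', ?_⟩
  rw [eLpNorm_lt_top_iff_lintegral_rpow_enorm_lt_top hp_ne ENNReal.ofReal_ne_top]
  rw [ENNReal.toReal_ofReal hp₀.le] at hf_fin ⊢
  exact (lintegral_enorm_convolution_rpow_le hp hf.1 hg.1 L).trans_lt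
    (ENNReal.mul_lt_top (ENNReal.rpow_lt_top_of_nonneg hp₀.le enorm_ne_top)
      (ENNReal.mul_lt_top hf_fin (ENNReal.rpow_lt_top_of_nonneg hp₀.le hg.2.ne)))

end Young

section RLIntegral

variable {E : Type*} [NormedAddCommGroup E] [NormedSpace ℝ E] {β γ s t T : ℝ} {f g : ℝ → E}

/-- The damped function `exp (-s t) f(t)`, extended by zero outside `[0, T]`, so that fractional
integrals on `[0, T]` become convolutions on `ℝ`. -/
noncomputable def dampedExtension (s T : ℝ) (f : ℝ → E) : ℝ → E :=
  indicator (Icc 0 T) fun t ↦ exp (-(s * t)) • f t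

theorem dampedExtension_of_mem (ht : t ∈ Icc 0 T) :
    dampedExtension s T f t = exp (-(s * t)) • f t :=
  indicator_of_mem ht _

theorem dampedExtension_of_notMem (ht : t ∉ Icc 0 T) : dampedExtension s T f t = 0 :=
  indicator_of_notMem ht _

theorem dampedExtension_add (s T : ℝ) (f g : ℝ → E) :
    dampedExtension s T (f + g) = dampedExtension s T f + dampedExtension s T g := by
  simp only [dampedExtension, Pi.add_apply, smul_add, indicator_add, Pi.add_def]

theorem integrable_dampedExtension (hf : IntegrableOn f (Icc 0 T)) :
    Integrable (dampedExtension s T f) := by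
  rw [dampedExtension, integrable_indicator_iff measurableSet_Icc]
  exact hf.continuousOn_smul (by fun_prop) isCompact_Icc

/-- Bielecki's weighted version of the `L¹` norm on `[0, T]`: it is equivalent to the `L¹` norm, and
`I^β` has norm at most `s^{-β}` for it, which is small for `s` large. -/
noncomputable def bieleckiNorm (s T : ℝ) (f : ℝ → E) : ℝ :=
  ∫ t in Icc 0 T, exp (-(s * t)) * ‖f t‖

theorem integral_norm_dampedExtension (s T : ℝ) (f : ℝ → E) :
    ∫ t, ‖dampedExtension s T f t‖ = bieleckiNorm s T f := by
  simp only [bieleckiNorm, dampedExtension, norm_indicator_eq_indicator_norm, norm_smul,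
    norm_of_nonneg (exp_pos _).le]
  exact integral_indicator measurableSet_Icc

theorem rlIntegral_eq_integral_rpow_smul (β : ℝ) (f : ℝ → E) (ht : 0 ≤ t) :
    rlIntegral β f t = (1 / Gamma β) • ∫ τ in (0 : ℝ)..t, (t - τ) ^ (β - 1) • f τ := by
  rw [rlIntegral]
  congr 1
  refine intervalIntegral.integral_congr fun τ hτ ↦ ?_
  rw [uIcc_of_le ht] at hτ
  rw [one_div, ← rpow_neg (sub_nonneg.2 hτ.2), neg_sub]

theorem rlKernel_convolution_dampedExtension (β s : ℝ) (f : ℝ → E) (ht : t ≤ T) :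
    (rlKernel β s ⋆[lsmul ℝ ℝ] dampedExtension s T f) t =
      dampedExtension s T (rlIntegral β f) t := by
  rcases lt_or_ge t 0 with ht₀ | ht₀
  · rw [dampedExtension_of_notMem fun h ↦ ht₀.not_ge h.1, rlKernel_convolution_congr (g := 0)
      fun τ hτ ↦ dampedExtension_of_notMem fun h ↦ (hτ.trans_lt ht₀).not_ge h.1, convolution_zero]
    rfl
  rw [dampedExtension_of_mem ⟨ht₀, ht⟩, rlIntegral_eq_integral_rpow_smul β f ht₀,
    convolution_eq_swap, intervalIntegral.integral_of_le ht₀, ← integral_smul, ← integral_smul,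
    ← integral_indicator measurableSet_Ioc]
  refine integral_congr_ae ?_
  filter_upwards [volume.ae_ne 0, volume.ae_ne t] with τ hτ₀ hτt
  rw [ContinuousLinearMap.lsmul_apply]
  by_cases hτ : τ ∈ Ioc 0 t
  · have hlt : 0 < t - τ := sub_pos.2 (lt_of_le_of_ne hτ.2 hτt)
    have hexp : exp (-(s * t)) = exp (-(s * (t - τ))) * exp (-(s * τ)) := by
      rw [← exp_add]; ring_nf
    rw [indicator_of_mem hτ, rlKernel_of_pos hlt,
      dampedExtension_of_mem ⟨hτ.1.le, hτ.2.trans ht⟩, smul_smul, smul_smul, smul_smul, hexp]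
    ring_nf
  · rw [indicator_of_notMem hτ]
    rcases lt_or_ge τ t with hlt | hge
    · rw [dampedExtension_of_notMem fun h ↦ hτ ⟨lt_of_le_of_ne h.1 hτ₀.symm, hlt.le⟩, smul_zero]
    · rw [rlKernel_of_nonpos (sub_nonpos.2 hge), zero_smul]

theorem rlIntegral_eq_exp_smul_convolution (β s : ℝ) (f : ℝ → E) (ht : t ∈ Icc 0 T) :
    rlIntegral β f t =
      exp (s * t) • (rlKernel β s ⋆[lsmul ℝ ℝ] dampedExtension s T f) t := by
  rw [rlKernel_convolution_dampedExtension β s f ht.2, dampedExtension_of_mem ht, smul_smul,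
    ← exp_add, add_neg_cancel, exp_zero, one_smul]

theorem rlIntegral_smul (β c : ℝ) (f : ℝ → E) : rlIntegral β (c • f) = c • rlIntegral β f := by
  ext t
  simp only [rlIntegral, Pi.smul_apply, smul_comm _ c, intervalIntegral.integral_smul]

theorem rlIntegral_add_ae (hβ : 0 < β) (hf : IntegrableOn f (Icc 0 T))
    (hg : IntegrableOn g (Icc 0 T)) :
    rlIntegral β (f + g) =ᵐ[volume.restrict (Icc 0 T)] rlIntegral β f + rlIntegral β g := by
  have hk := integrable_rlKernel hβ one_pos
  rw [EventuallyEq, ae_restrict_iff' measurableSet_Icc]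
  filter_upwards [hk.ae_convolution_exists (lsmul ℝ ℝ) (integrable_dampedExtension (s := 1) hf),
    hk.ae_convolution_exists (lsmul ℝ ℝ) (integrable_dampedExtension (s := 1) hg)] with t hft hgt ht
  simp only [Pi.add_apply, rlIntegral_eq_exp_smul_convolution β 1 _ ht, dampedExtension_add]
  rw [ConvolutionExistsAt.distrib_add hft hgt, smul_add]

theorem rlIntegral_congr_ae (β : ℝ) (h : f =ᵐ[volume.restrict (Icc 0 T)] g) (ht : t ∈ Icc 0 T) :
    rlIntegral β f t = rlIntegral β g t := by
  rw [rlIntegral, rlIntegral]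
  congr 1
  refine intervalIntegral.integral_congr_ae ?_
  rw [EventuallyEq, ae_restrict_iff' measurableSet_Icc] at h
  filter_upwards [h] with τ hτ hmem
  rw [uIoc_of_le ht.1] at hmem
  rw [hτ ⟨hmem.1.le, hmem.2.trans ht.2⟩]

theorem memLp_rlIntegral {p : ℝ} (hβ : 0 < β) (hp : 1 ≤ p) (hpβ : p * (1 - β) < 1)
    (hf : IntegrableOn f (Icc 0 T)) :
    MemLp (rlIntegral β f) (ENNReal.ofReal p) (volume.restrict (Icc 0 T)) := by
  have hconv := (memLp_convolution hp (memLp_rlKernel hβ one_pos (by linarith) hpβ)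
    (integrable_dampedExtension (s := 1) hf) (lsmul ℝ ℝ)).restrict (Icc 0 T)
  refine (hconv.of_le_mul (f := fun t ↦ exp (1 * t) • _) (c := exp T)
    ((by fun_prop : Continuous fun t : ℝ ↦ exp (1 * t)).aestronglyMeasurable.smul hconv.1)
      ?_).ae_eq ?_
  · filter_upwards [ae_restrict_mem measurableSet_Icc] with t ht
    rw [norm_smul, norm_of_nonneg (exp_pos _).le, one_mul]
    gcongr
    exact ht.2
  · filter_upwards [ae_restrict_mem measurableSet_Icc] with t ht
    exact (rlIntegral_eq_exp_smul_convolution β 1 f ht).symm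

theorem integrableOn_rlIntegral (hβ : 0 < β) (hf : IntegrableOn f (Icc 0 T)) :
    IntegrableOn (rlIntegral β f) (Icc 0 T) := by
  rw [IntegrableOn, ← memLp_one_iff_integrable, ← ENNReal.ofReal_one]
  exact memLp_rlIntegral hβ le_rfl (by linarith) hf

theorem bieleckiNorm_rlIntegral_le (hβ : 0 < β) (hs : 0 < s) (hf : IntegrableOn f (Icc 0 T)) :
    bieleckiNorm s T (rlIntegral β f) ≤ (1 / s) ^ β * bieleckiNorm s T f := by
  have hk := integrable_rlKernel hβ hs
  have hd := integrable_dampedExtension (s := s) hf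
  rw [← integral_norm_dampedExtension, ← integral_norm_dampedExtension]
  calc ∫ t, ‖dampedExtension s T (rlIntegral β f) t‖
      ≤ ∫ t, ((‖rlKernel β s ·‖) ⋆[.mul ℝ ℝ] (‖dampedExtension s T f ·‖)) t := by
        refine integral_mono (integrable_dampedExtension (integrableOn_rlIntegral hβ hf)).norm
          (hk.norm.integrable_convolution _ hd.norm) fun t ↦ ?_
        by_cases ht : t ∈ Icc 0 T
        · simp only [← rlKernel_convolution_dampedExtension β s f ht.2]
          refine (norm_integral_le_integral_norm _).trans_eq ?_
          simp only [convolution, ContinuousLinearMap.lsmul_apply, norm_smul,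
            ContinuousLinearMap.mul_apply']
        · simp only [dampedExtension_of_notMem ht, norm_zero]
          exact integral_nonneg fun τ ↦ mul_nonneg (norm_nonneg _) (norm_nonneg _)
    _ = (1 / s) ^ β * ∫ t, ‖dampedExtension s T f t‖ := by
      rw [integral_convolution _ hk.norm hd.norm]
      simp only [norm_of_nonneg (rlKernel_nonneg hβ s _), integral_rlKernel hβ hs,
        ContinuousLinearMap.mul_apply']

theorem rlIntegral_rlIntegral_ae [CompleteSpace E] (hβ : 0 < β) (hγ : 0 < γ)
    (hf : IntegrableOn f (Icc 0 T)) :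
    rlIntegral β (rlIntegral γ f) =ᵐ[volume.restrict (Icc 0 T)] rlIntegral (β + γ) f := by
  have hkβ := integrable_rlKernel hβ one_pos
  have hkγ := integrable_rlKernel hγ one_pos
  have hd := integrable_dampedExtension (s := 1) hf
  have hex := hkβ.norm.ae_convolution_exists (.mul ℝ ℝ)
    (hkγ.norm.integrable_convolution (.mul ℝ ℝ) hd.norm)
  rw [EventuallyEq, ae_restrict_iff' measurableSet_Icc]
  filter_upwards [hex] with t hex ht
  have hassoc := convolution_assoc (lsmul ℝ ℝ) (lsmul ℝ ℝ) (lsmul ℝ ℝ) (lsmul ℝ ℝ)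
    (fun x y z ↦ mul_smul x y z) hkβ.aestronglyMeasurable hkγ.aestronglyMeasurable
    hd.aestronglyMeasurable (hkβ.ae_convolution_exists _ hkγ)
    (hkγ.norm.ae_convolution_exists _ hd.norm) hex
  rw [rlKernel_convolution_rlKernel hβ hγ] at hassoc
  rw [rlIntegral_eq_exp_smul_convolution β 1 _ ht, rlIntegral_eq_exp_smul_convolution _ 1 f ht,
    hassoc, rlKernel_convolution_congr fun τ hτ ↦
      (rlKernel_convolution_dampedExtension γ 1 f (hτ.trans ht.2)).symm]

theorem rlIntegral_one (f : ℝ → E) (t : ℝ) : rlIntegral 1 f t = ∫ τ in (0 : ℝ)..t, f τ := by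
  simp only [rlIntegral, Gamma_one, sub_self, rpow_zero, div_one, one_smul]

theorem rlIntegral_rpow_smul [CompleteSpace E] (hβ : 0 < β) (hγ : 0 < γ) (ht : 0 < t) (c : E) :
    rlIntegral β (fun τ ↦ τ ^ (γ - 1) • c) t =
      (Gamma γ / Gamma (β + γ) * t ^ (β + γ - 1)) • c := by
  have hΓ := (Gamma_pos_of_pos hβ).ne'
  simp only [rlIntegral_eq_integral_rpow_smul β _ ht.le, smul_smul]
  rw [intervalIntegral.integral_smul_const, smul_smul]
  simp only [mul_comm ((t - _) ^ (β - 1)), integral_rpow_mul_sub_rpow hγ hβ ht, add_comm γ β]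
  congr 1
  field_simp

theorem memLp_rpow_smul {p : ℝ} (hβ : 0 < β) (hp : 0 < p) (hpβ : p * (1 - β) < 1) (c : E) :
    MemLp (fun t : ℝ ↦ t ^ (β - 1) • c) (ENNReal.ofReal p) (volume.restrict (Icc 0 T)) := by
  have hmeas : Measurable fun t : ℝ ↦ t ^ (β - 1) := by fun_prop
  refine ((memLp_rlKernel hβ one_pos hp hpβ).restrict (Icc 0 T)).of_le_mul
    (c := exp T * Gamma β * ‖c‖) (hmeas.aestronglyMeasurable.smul_const c) ?_
  filter_upwards [ae_restrict_mem measurableSet_Icc,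
    (volume.restrict (Icc 0 T)).ae_ne 0] with t ht ht₀
  have ht_pos : 0 < t := lt_of_le_of_ne ht.1 ht₀.symm
  have hexp : 1 ≤ exp T * exp (-t) := by
    rw [← exp_add]
    exact one_le_exp (by linarith [ht.2])
  rw [norm_smul, norm_of_nonneg (rlKernel_nonneg hβ 1 t), rlKernel_of_pos ht_pos, one_mul,
    norm_of_nonneg (by positivity)]
  calc t ^ (β - 1) * ‖c‖ ≤ (exp T * exp (-t)) * (t ^ (β - 1) * ‖c‖) :=
        le_mul_of_one_le_left (by positivity) hexp
    _ = _ := by field_simp [(Gamma_pos_of_pos hβ).ne']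

end RLIntegral

section Minimization

variable {X : Type*} [NormedAddCommGroup X] [NormedSpace ℝ X] {C : Set X} {f : X → ℝ≥0∞}
  {κ : ℝ≥0∞}

theorem cauchySeq_of_tendsto_of_midpoint_le (hC : Convex ℝ C) (hκ : κ ≠ 0)
    (hf : ∀ u ∈ C, ∀ v ∈ C, 2 * f (midpoint ℝ u v) + κ * ‖u - v‖ₑ ^ 2 ≤ f u + f v)
    {m : ℝ≥0∞} (hm : m ≠ ⊤) (hle : ∀ u ∈ C, m ≤ f u) {u : ℕ → X} (hu : ∀ n, u n ∈ C)
    (hlim : Tendsto (fun n ↦ f (u n)) atTop (𝓝 m)) : CauchySeq u := by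
  refine EMetric.cauchySeq_iff.2 fun ε hε ↦ ?_
  have hη : κ * ε ^ 2 / 2 ≠ 0 := by simp [hκ, hε.ne']
  obtain ⟨n₀, hn₀⟩ := eventually_atTop.1 (hlim.eventually_lt_const (ENNReal.lt_add_right hm hη))
  refine ⟨n₀, fun j hj k hk ↦ lt_of_not_ge fun hjk ↦ ?_⟩
  rw [edist_eq_enorm_sub] at hjk
  refine lt_irrefl (2 * m + κ * ε ^ 2) ?_
  calc
    _ ≤ 2 * m + κ * ‖u j - u k‖ₑ ^ 2 := by gcongr
    _ ≤ 2 * f (midpoint ℝ (u j) (u k)) + κ * ‖u j - u k‖ₑ ^ 2 := by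
      gcongr
      exact hle _ (hC.midpoint_mem (hu j) (hu k))
    _ ≤ f (u j) + f (u k) := hf _ (hu j) _ (hu k)
    _ < (m + κ * ε ^ 2 / 2) + (m + κ * ε ^ 2 / 2) := ENNReal.add_lt_add (hn₀ j hj) (hn₀ k hk)
    _ = _ := by rw [add_add_add_comm, ← two_mul, ENNReal.add_halves]

theorem exists_isMinOn_of_midpoint_le [CompleteSpace X] (hC : Convex ℝ C) (hC_closed : IsClosed C)
    (hC_nonempty : C.Nonempty) (hf_lsc : LowerSemicontinuous f) (hκ : κ ≠ 0)
    (hf : ∀ u ∈ C, ∀ v ∈ C, 2 * f (midpoint ℝ u v) + κ * ‖u - v‖ₑ ^ 2 ≤ f u + f v) :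
    ∃ u ∈ C, IsMinOn f C u := by
  have hle : ∀ u ∈ C, sInf (f '' C) ≤ f u := fun u hu ↦ sInf_le (mem_image_of_mem f hu)
  by_cases hm : sInf (f '' C) = ⊤
  · obtain ⟨u, hu⟩ := hC_nonempty
    exact ⟨u, hu, fun v hv ↦ le_top.trans (hm.symm.le.trans (hle v hv))⟩
  obtain ⟨r, -, hr, hr_mem⟩ := exists_seq_tendsto_sInf (hC_nonempty.image f) (OrderBot.bddBelow _)
  choose u hu hur using hr_mem
  obtain rfl : (fun n ↦ f (u n)) = r := funext hur
  obtain ⟨w, hw⟩ := cauchySeq_tendsto_of_complete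
    (cauchySeq_of_tendsto_of_midpoint_le hC hκ hf hm hle hu hr)
  refine ⟨w, hC_closed.mem_of_tendsto hw (.of_forall hu), fun v hv ↦ ?_⟩
  exact ((hf_lsc.le_liminf w).trans hw.liminf_le_liminf_comp).trans
    (hr.liminf_eq.trans_le (hle v hv))

end Minimization

section IntegralFunctional

variable {Ω E : Type*} [MeasurableSpace Ω] {μ : Measure Ω} [NormedAddCommGroup E]
  {p : ℝ≥0∞}

theorem sq_lintegral_enorm_le {f : Ω → E} (hf : AEStronglyMeasurable f μ) :
    (∫⁻ a, ‖f a‖ₑ ∂μ) ^ 2 ≤ (∫⁻ a, ‖f a‖ₑ ^ 2 ∂μ) * μ univ := by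
  simpa only [mul_one, lintegral_one, ENNReal.rpow_two, (by norm_num : (2 : ℝ) - 1 = 1),
    ENNReal.rpow_one] using lintegral_mul_rpow_le one_le_two hf.enorm (aemeasurable_const (b := 1))

theorem div_mul_sq_enorm_sub_le_lintegral (κ : ℝ≥0∞) (f g : Lp E 1 μ) :
    κ / μ univ * ‖f - g‖ₑ ^ 2 ≤ ∫⁻ a, κ * ‖f a - g a‖ₑ ^ 2 ∂μ := by
  have hnorm : ‖f - g‖ₑ = ∫⁻ a, ‖f a - g a‖ₑ ∂μ := by
    simp only [← edist_eq_enorm_sub, L1.edist_def]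
  calc κ / μ univ * ‖f - g‖ₑ ^ 2
      ≤ κ / μ univ * ((∫⁻ a, ‖f a - g a‖ₑ ^ 2 ∂μ) * μ univ) := by
        rw [hnorm]
        gcongr
        exact sq_lintegral_enorm_le ((Lp.aestronglyMeasurable f).sub (Lp.aestronglyMeasurable g))
    _ = μ univ * (κ / μ univ) * ∫⁻ a, ‖f a - g a‖ₑ ^ 2 ∂μ := by ring
    _ ≤ κ * ∫⁻ a, ‖f a - g a‖ₑ ^ 2 ∂μ := by
        gcongr
        exact ENNReal.mul_div_le
    _ ≤ ∫⁻ a, κ * ‖f a - g a‖ₑ ^ 2 ∂μ := lintegral_const_mul_le _ _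

section

variable [NormedSpace ℝ E]

theorem convex_setOf_ae_mem {U : Set E} (hU : Convex ℝ U) :
    Convex ℝ {f : Lp E p μ | ∀ᵐ a ∂μ, f a ∈ U} := by
  intro f hf g hg r s hr hs hrs
  filter_upwards [hf, hg, Lp.coeFn_add (r • f) (s • g), Lp.coeFn_smul r f, Lp.coeFn_smul s g]
    with a hfa hga hadd hrf hsg
  rw [hadd, Pi.add_apply, hrf, hsg]
  exact hU hfa hga hr hs hrs

theorem coeFn_midpoint_ae [Fact (1 ≤ p)] (f g : Lp E p μ) :
    (midpoint ℝ f g : Lp E p μ) =ᵐ[μ] fun a ↦ midpoint ℝ (f a) (g a) := by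
  rw [midpoint_eq_smul_add]
  filter_upwards [Lp.coeFn_smul (⅟2 : ℝ) (f + g), Lp.coeFn_add f g] with a hsmul hadd
  rw [hsmul, Pi.smul_apply, hadd, Pi.add_apply, midpoint_eq_smul_add]

theorem lintegral_comp_midpoint_le [Fact (1 ≤ p)] {L : E → ℝ≥0∞} {q : E → E → ℝ≥0∞}
    (hL : LowerSemicontinuous L) (h : ∀ y z, 2 * L (midpoint ℝ y z) + q y z ≤ L y + L z)
    (f g : Lp E p μ) :
    2 * ∫⁻ a, L ((midpoint ℝ f g : Lp E p μ) a) ∂μ + ∫⁻ a, q (f a) (g a) ∂μ ≤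
      ∫⁻ a, L (f a) ∂μ + ∫⁻ a, L (g a) ∂μ := by
  borelize E
  have hLf : AEMeasurable (fun a ↦ L (f a)) μ :=
    hL.measurable.comp_aemeasurable (Lp.aestronglyMeasurable f).aemeasurable
  rw [← lintegral_add_left' hLf, ← lintegral_const_mul' _ _ ENNReal.ofNat_ne_top]
  refine (le_lintegral_add _ _).trans (lintegral_mono_ae ?_)
  filter_upwards [coeFn_midpoint_ae f g] with a ha
  rw [ha]
  exact h _ _

end

variable [Fact (1 ≤ p)]

theorem exists_subseq_tendsto_ae_of_tendsto_Lp {f : ℕ → Lp E p μ} {g : Lp E p μ}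
    (hfg : Tendsto f atTop (𝓝 g)) : ∃ ns : ℕ → ℕ, StrictMono ns ∧
      ∀ᵐ a ∂μ, Tendsto (fun i ↦ f (ns i) a) atTop (𝓝 (g a)) :=
  (tendstoInMeasure_of_tendsto_Lp hfg).exists_seq_tendsto_ae

theorem lowerSemicontinuous_lintegral_comp {L : E → ℝ≥0∞} (hL : LowerSemicontinuous L) :
    LowerSemicontinuous fun f : Lp E p μ ↦ ∫⁻ a, L (f a) ∂μ := by
  borelize E
  refine lowerSemicontinuous_iff_isClosed_preimage.2 fun r ↦
    IsSeqClosed.isClosed fun f g hf hfg ↦ ?_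
  obtain ⟨ns, -, hae⟩ := exists_subseq_tendsto_ae_of_tendsto_Lp hfg
  calc ∫⁻ a, L (g a) ∂μ ≤ ∫⁻ a, liminf (fun i ↦ L (f (ns i) a)) atTop ∂μ := by
        refine lintegral_mono_ae ?_
        filter_upwards [hae] with a ha
        exact (hL.le_liminf _).trans ha.liminf_le_liminf_comp
    _ ≤ liminf (fun i ↦ ∫⁻ a, L (f (ns i) a) ∂μ) atTop :=
        lintegral_liminf_le' fun i ↦
          hL.measurable.comp_aemeasurable (Lp.aestronglyMeasurable _).aemeasurable
    _ ≤ r := liminf_le_of_frequently_le' (.of_forall fun i ↦ hf (ns i))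

theorem isClosed_setOf_ae_mem {U : Set E} (hU : IsClosed U) :
    IsClosed {f : Lp E p μ | ∀ᵐ a ∂μ, f a ∈ U} := by
  refine IsSeqClosed.isClosed fun f g hf hfg ↦ ?_
  obtain ⟨ns, -, hae⟩ := exists_subseq_tendsto_ae_of_tendsto_Lp hfg
  filter_upwards [hae, ae_all_iff.2 fun i ↦ hf (ns i)] with a ha hmem
  exact hU.mem_of_tendsto ha (.of_forall hmem)

theorem exists_coeFn_graph_ae {V : Type*} [NormedAddCommGroup V] [NormedSpace ℝ E]
    [NormedSpace ℝ V] (S : Lp V p μ →ᴬ[ℝ] Lp E p μ) :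
    ∃ Z : Lp V p μ →ᴬ[ℝ] Lp (E × V) p μ, ∀ u, Z u =ᵐ[μ] fun a ↦ (S u a, u a) := by
  refine ⟨((ContinuousLinearMap.inl ℝ E V).compLpL p μ).toContinuousAffineMap.comp S +
    ((ContinuousLinearMap.inr ℝ E V).compLpL p μ).toContinuousAffineMap, fun u ↦ ?_⟩
  filter_upwards [Lp.coeFn_add ((ContinuousLinearMap.inl ℝ E V).compLpL p μ (S u))
      ((ContinuousLinearMap.inr ℝ E V).compLpL p μ u),
    (ContinuousLinearMap.inl ℝ E V).coeFn_compLpL (p := p) (S u),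
    (ContinuousLinearMap.inr ℝ E V).coeFn_compLpL (p := p) u] with a hadd hinl hinr
  refine hadd.trans ?_
  rw [Pi.add_apply, hinl, hinr]
  simp

theorem exists_isMinOn_lintegral_comp_affine {V : Type*} [NormedAddCommGroup V] [NormedSpace ℝ E]
    [NormedSpace ℝ V] [CompleteSpace V] [IsFiniteMeasure μ] {U : Set V} (hU : Convex ℝ U)
    (hU_closed : IsClosed U) (hU_nonempty : U.Nonempty) (S : Lp V 1 μ →ᴬ[ℝ] Lp E 1 μ)
    {L : E × V → ℝ≥0∞} (hL : LowerSemicontinuous L) {κ : ℝ≥0∞} (hκ : κ ≠ 0)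
    (hL_mid : ∀ y z, 2 * L (midpoint ℝ y z) + κ * ‖y.2 - z.2‖ₑ ^ 2 ≤ L y + L z) :
    ∃ u ∈ {u : Lp V 1 μ | ∀ᵐ a ∂μ, u a ∈ U},
      IsMinOn (fun u : Lp V 1 μ ↦ ∫⁻ a, L (S u a, u a) ∂μ) {u | ∀ᵐ a ∂μ, u a ∈ U} u := by
  obtain ⟨Z, hZ⟩ := exists_coeFn_graph_ae S
  have hF : ∀ u, ∫⁻ a, L (S u a, u a) ∂μ = ∫⁻ a, L (Z u a) ∂μ := fun u ↦
    lintegral_congr_ae ((hZ u).symm.fun_comp L)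
  have hdiff : ∀ u v : Lp V 1 μ, κ / μ univ * ‖u - v‖ₑ ^ 2 ≤
      ∫⁻ a, κ * ‖(Z u a).2 - (Z v a).2‖ₑ ^ 2 ∂μ := fun u v ↦ by
    refine (div_mul_sq_enorm_sub_le_lintegral κ u v).trans_eq (lintegral_congr_ae ?_)
    filter_upwards [hZ u, hZ v] with a hu hv
    rw [hu, hv]
  simp only [hF]
  obtain ⟨c, hc⟩ := hU_nonempty
  refine exists_isMinOn_of_midpoint_le (convex_setOf_ae_mem hU) (isClosed_setOf_ae_mem hU_closed)
    ⟨Lp.const 1 μ c, ?_⟩ ((lowerSemicontinuous_lintegral_comp hL).comp Z.continuous)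
    (ENNReal.div_ne_zero.2 ⟨hκ, measure_ne_top μ univ⟩) fun u _ v _ ↦ ?_
  · filter_upwards [Lp.coeFn_const 1 μ c] with a ha
    rwa [ha]
  · rw [show Z (midpoint ℝ u v) = midpoint ℝ (Z u) (Z v) from Z.toAffineMap.map_midpoint u v]
    exact (add_le_add_right (hdiff u v) _).trans (lintegral_comp_midpoint_le hL hL_mid _ _)

end IntegralFunctional

section RLAntideriv

variable {E : Type*} [NormedAddCommGroup E] [NormedSpace ℝ E] {α β p T : ℝ} {f g v : ℝ → E}

/-- The function `I^α[v](t) + t^{α-1} y₀ / Γ(α)`, which has Riemann–Liouville derivative `v` of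
order `α` and initial value `I^{1-α}(0) = y₀`. -/
noncomputable def rlAntideriv (α : ℝ) (v : ℝ → E) (y₀ : E) : ℝ → E :=
  rlIntegral α v + fun t ↦ t ^ (α - 1) • (1 / Gamma α) • y₀

theorem memLp_rlAntideriv (hα : 0 < α) (hp : 1 ≤ p) (hpα : p * (1 - α) < 1)
    (hv : IntegrableOn v (Icc 0 T)) (y₀ : E) :
    MemLp (rlAntideriv α v y₀) (ENNReal.ofReal p) (volume.restrict (Icc 0 T)) :=
  (memLp_rlIntegral hα hp hpα hv).add (memLp_rpow_smul hα (by linarith) hpα _)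

theorem integrableOn_rpow_smul (hα : 0 < α) (c : E) :
    IntegrableOn (fun t : ℝ ↦ t ^ (α - 1) • c) (Icc 0 T) := by
  rw [IntegrableOn, ← memLp_one_iff_integrable, ← ENNReal.ofReal_one]
  exact memLp_rpow_smul hα one_pos (by linarith) c

theorem integrableOn_rlAntideriv (hα : 0 < α) (hv : IntegrableOn v (Icc 0 T)) (y₀ : E) :
    IntegrableOn (rlAntideriv α v y₀) (Icc 0 T) :=
  (integrableOn_rlIntegral hα hv).add (integrableOn_rpow_smul hα _)

variable [CompleteSpace E]

theorem ae_eq_of_rlIntegral_ae_eq (hβ₀ : 0 < β) (hβ₁ : β < 1) (hT : 0 < T)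
    (hf : IntegrableOn f (Icc 0 T)) (hg : IntegrableOn g (Icc 0 T))
    (h : rlIntegral β f =ᵐ[volume.restrict (Icc 0 T)] rlIntegral β g) :
    f =ᵐ[volume.restrict (Icc 0 T)] g := by
  have hprim : ∀ {f : ℝ → E}, IntegrableOn f (Icc 0 T) →
      rlIntegral (1 - β) (rlIntegral β f) =ᵐ[volume.restrict (Icc 0 T)]
        fun t ↦ ∫ τ in (0 : ℝ)..t, f τ := fun hf ↦ by
    filter_upwards [rlIntegral_rlIntegral_ae (sub_pos.2 hβ₁) hβ₀ hf] with t ht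
    rw [ht, sub_add_cancel, rlIntegral_one]
  have hsub : f - g =ᵐ[volume.restrict (Icc 0 T)] 0 := by
    refine ae_eq_zero_of_primitive_ae_eq_zero hT (hf.sub hg) ?_
    filter_upwards [hprim hf, hprim hg, ae_restrict_mem measurableSet_Icc] with t hft hgt ht
    have hint : ∀ {f : ℝ → E}, IntegrableOn f (Icc 0 T) → IntervalIntegrable f volume 0 t :=
      fun hf ↦ (intervalIntegrable_iff_integrableOn_Icc_of_le ht.1).2
        (hf.mono_set (Icc_subset_Icc_right ht.2))
    simp only [Pi.sub_apply]
    rw [intervalIntegral.integral_sub (hint hf) (hint hg), ← hft, ← hgt,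
      rlIntegral_congr_ae _ h ht, sub_self, Pi.zero_apply]
  filter_upwards [hsub] with t ht
  exact sub_eq_zero.1 ht

theorem rlIntegral_rlAntideriv_ae (hα₀ : 0 < α) (hα₁ : α < 1)
    (hv : IntegrableOn v (Icc 0 T)) (y₀ : E) :
    rlIntegral (1 - α) (rlAntideriv α v y₀) =ᵐ[volume.restrict (Icc 0 T)]
      fun t ↦ y₀ + ∫ τ in (0 : ℝ)..t, v τ := by
  have hα₁' := sub_pos.2 hα₁
  have hΓ := (Gamma_pos_of_pos hα₀).ne'
  filter_upwards [rlIntegral_add_ae hα₁' (integrableOn_rlIntegral hα₀ hv)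
      (integrableOn_rpow_smul hα₀ ((1 / Gamma α) • y₀)),
    rlIntegral_rlIntegral_ae hα₁' hα₀ hv, ae_restrict_mem measurableSet_Icc,
    (volume.restrict (Icc 0 T)).ae_ne 0] with t hadd hsemi ht ht₀
  rw [rlAntideriv, hadd, Pi.add_apply, hsemi,
    rlIntegral_rpow_smul hα₁' hα₀ (lt_of_le_of_ne ht.1 ht₀.symm), sub_add_cancel, rlIntegral_one,
    Gamma_one, sub_self, rpow_zero, smul_smul, div_one, mul_one, mul_one_div_cancel hΓ, one_smul,
    add_comm]

theorem HasRLDerivWithInit.ae_eq_rlAntideriv (hα₀ : 0 < α) (hα₁ : α < 1) (hT : 0 < T)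
    (hv : IntegrableOn v (Icc 0 T)) {y₀ : E} (h : HasRLDerivWithInit α T f v y₀) :
    f =ᵐ[volume.restrict (Icc 0 T)] rlAntideriv α v y₀ := by
  obtain ⟨hf, F, hF_ac, hF, hF_deriv, hF₀⟩ := h
  refine ae_eq_of_rlIntegral_ae_eq (sub_pos.2 hα₁) (by linarith) hT hf
    (integrableOn_rlAntideriv hα₀ hv y₀) ?_
  filter_upwards [hF, rlIntegral_rlAntideriv_ae hα₀ hα₁ hv y₀, ae_restrict_mem measurableSet_Icc]
    with t hFt hmild ht
  rw [← uIcc_of_le hT.le] at ht hF_deriv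
  rw [← hFt, hmild, eq_add_integral_of_absolutelyContinuousOnInterval hF_ac
    ((intervalIntegrable_iff_integrableOn_Icc_of_le hT.le).2 hv)
    ((ae_restrict_iff' measurableSet_uIcc).1 hF_deriv) ht, hF₀]

theorem hasRLDerivWithInit_iff_ae_eq_rlAntideriv (hα₀ : 0 < α) (hα₁ : α < 1) (hT : 0 < T)
    (hv : IntegrableOn v (Icc 0 T)) {y₀ : E} :
    HasRLDerivWithInit α T f v y₀ ↔ f =ᵐ[volume.restrict (Icc 0 T)] rlAntideriv α v y₀ := by
  refine ⟨fun h ↦ h.ae_eq_rlAntideriv hα₀ hα₁ hT hv, fun h ↦ ?_⟩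
  have hi := (intervalIntegrable_iff_integrableOn_Icc_of_le hT.le).2 hv
  refine ⟨(integrableOn_rlAntideriv hα₀ hv y₀).congr h.symm,
    fun t ↦ y₀ + ∫ τ in (0 : ℝ)..t, v τ, ?_, ?_, ?_, by simp⟩
  · exact (LipschitzWith.const y₀).lipschitzOnWith.absolutelyContinuousOnInterval.add
      (absolutelyContinuousOnInterval_primitive hi left_mem_uIcc)
  · filter_upwards [rlIntegral_rlAntideriv_ae hα₀ hα₁ hv y₀, ae_restrict_mem measurableSet_Icc]
      with t hmild ht
    rw [rlIntegral_congr_ae _ h ht, hmild]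
  · rw [ae_restrict_iff' measurableSet_Icc, ← uIcc_of_le hT.le]
    filter_upwards [hi.ae_hasDerivAt_integral] with t hd ht
    exact (hd ht 0 left_mem_uIcc).const_add y₀

end RLAntideriv

section Volterra

theorem isUnit_one_sub_of_equivalent_contraction {X : Type*} [NormedAddCommGroup X]
    [NormedSpace ℝ X] [CompleteSpace X] {P : X →L[ℝ] X} {N : X → ℝ} {c r : ℝ} (hc : 0 < c)
    (hr₀ : 0 ≤ r) (hr₁ : r < 1) (hN_lower : ∀ z, c * ‖z‖ ≤ N z) (hN_upper : ∀ z, N z ≤ ‖z‖)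
    (hP : ∀ z, N (P z) ≤ r * N z) : IsUnit (1 - P) := by
  have hpow : ∀ n z, N ((P ^ n) z) ≤ r ^ n * N z := fun n z ↦ by
    induction n with
    | zero => simp
    | succ n ih =>
      rw [pow_succ', mul_apply_eq_comp, pow_succ', mul_assoc]
      exact (hP _).trans (mul_le_mul_of_nonneg_left ih hr₀)
  have hnorm : ∀ n, ‖P ^ n‖ ≤ r ^ n / c := fun n ↦
    ContinuousLinearMap.opNorm_le_bound _ (by positivity) fun z ↦ by
      rw [div_mul_eq_mul_div, le_div_iff₀' hc]
      exact (hN_lower _).trans ((hpow n z).trans (by gcongr; exact hN_upper z))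
  obtain ⟨n, hn⟩ := exists_pow_lt_of_lt_one hc hr₁
  have hunit : IsUnit (1 - P ^ n) :=
    isUnit_one_sub_of_norm_lt_one ((hnorm n).trans_lt ((div_lt_one hc).2 hn))
  rw [← mul_neg_geom_sum, (Commute.sum_right _ _ _ fun i _ ↦
    (Commute.one_left _).sub_left (Commute.self_pow P i)).isUnit_mul_iff] at hunit
  exact hunit.1

variable {E V : Type*} [NormedAddCommGroup E] [NormedAddCommGroup V] {α β s T : ℝ} {f g : ℝ → E}

theorem toL1_eq_iff_ae_eq {μ : Measure ℝ} (hf : Integrable f μ) {z : ℝ →₁[μ] E} :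
    hf.toL1 f = z ↔ f =ᵐ[μ] z := by
  rw [Lp.ext_iff]
  exact hf.coeFn_toL1.congr_left

theorem bieleckiNorm_congr_ae (s : ℝ) (h : f =ᵐ[volume.restrict (Icc 0 T)] g) :
    bieleckiNorm s T f = bieleckiNorm s T g :=
  integral_congr_ae (by filter_upwards [h] with t ht; rw [ht])

theorem integrableOn_exp_mul_norm (s : ℝ) (hf : IntegrableOn f (Icc 0 T)) :
    IntegrableOn (fun t ↦ exp (-(s * t)) * ‖f t‖) (Icc 0 T) :=
  IntegrableOn.continuousOn_smul (f := fun t ↦ exp (-(s * t))) hf.norm (by fun_prop) isCompact_Icc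

theorem bieleckiNorm_le_norm (hs : 0 ≤ s) (z : ℝ →₁[volume.restrict (Icc 0 T)] E) :
    bieleckiNorm s T z ≤ ‖z‖ := by
  rw [L1.norm_eq_integral_norm, bieleckiNorm]
  refine setIntegral_mono_on (integrableOn_exp_mul_norm s (L1.integrable_coeFn z))
    (L1.integrable_coeFn z).norm measurableSet_Icc fun t ht ↦ ?_
  exact mul_le_of_le_one_left (norm_nonneg _)
    (exp_le_one_iff.2 (neg_nonpos.2 (mul_nonneg hs ht.1)))

theorem exp_mul_norm_le_bieleckiNorm (hs : 0 ≤ s) (z : ℝ →₁[volume.restrict (Icc 0 T)] E) :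
    exp (-(s * T)) * ‖z‖ ≤ bieleckiNorm s T z := by
  rw [L1.norm_eq_integral_norm, bieleckiNorm, ← integral_const_mul]
  refine setIntegral_mono_on ((L1.integrable_coeFn z).norm.const_mul _)
    (integrableOn_exp_mul_norm s (L1.integrable_coeFn z)) measurableSet_Icc fun t ht ↦ ?_
  gcongr
  exact ht.2

variable [NormedSpace ℝ E] [NormedSpace ℝ V]

theorem bieleckiNorm_comp_le (s : ℝ) (A : V →L[ℝ] E) {f : ℝ → V} (hf : IntegrableOn f (Icc 0 T)) :
    bieleckiNorm s T (fun t ↦ A (f t)) ≤ ‖A‖ * bieleckiNorm s T f := by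
  rw [bieleckiNorm, bieleckiNorm, ← integral_const_mul]
  refine integral_mono (integrableOn_exp_mul_norm s (A.integrable_comp hf))
    ((integrableOn_exp_mul_norm s hf).const_mul _) fun t ↦ ?_
  simp only [mul_left_comm ‖A‖]
  gcongr
  exact A.le_opNorm _

theorem integrable_rlIntegral_coeFn (hβ : 0 < β) (z : ℝ →₁[volume.restrict (Icc 0 T)] E) :
    Integrable (rlIntegral β z) (volume.restrict (Icc 0 T)) :=
  integrableOn_rlIntegral hβ (L1.integrable_coeFn z)

theorem norm_toL1_rlIntegral_le (hβ : 0 < β) (z : ℝ →₁[volume.restrict (Icc 0 T)] E) :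
    ‖(integrable_rlIntegral_coeFn hβ z).toL1 _‖ ≤ exp T * ‖z‖ := by
  have hle := calc exp (-(1 * T)) * ‖(integrable_rlIntegral_coeFn hβ z).toL1 _‖
      ≤ bieleckiNorm 1 T ((integrable_rlIntegral_coeFn hβ z).toL1 _) :=
        exp_mul_norm_le_bieleckiNorm zero_le_one _
    _ = bieleckiNorm 1 T (rlIntegral β z) := bieleckiNorm_congr_ae 1 (Integrable.coeFn_toL1 _)
    _ ≤ (1 / 1) ^ β * bieleckiNorm 1 T z :=
        bieleckiNorm_rlIntegral_le hβ one_pos (L1.integrable_coeFn z)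
    _ = bieleckiNorm 1 T z := by rw [div_one, one_rpow, one_mul]
    _ ≤ ‖z‖ := bieleckiNorm_le_norm zero_le_one z
  rwa [one_mul, exp_neg, inv_mul_le_iff₀ (exp_pos T)] at hle

/-- The fractional integral `I^β` as a bounded operator on `L¹([0, T]; E)`. -/
noncomputable def rlIntegralL1 (hβ : 0 < β) (T : ℝ) :
    (ℝ →₁[volume.restrict (Icc 0 T)] E) →L[ℝ] (ℝ →₁[volume.restrict (Icc 0 T)] E) :=
  LinearMap.mkContinuous
    { toFun := fun z ↦ (integrable_rlIntegral_coeFn hβ z).toL1 _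
      map_add' := fun y z ↦ by
        rw [← Integrable.toL1_add, Integrable.toL1_eq_toL1_iff]
        refine .trans ?_ (rlIntegral_add_ae hβ (L1.integrable_coeFn y) (L1.integrable_coeFn z))
        filter_upwards [ae_restrict_mem measurableSet_Icc] with t ht
        exact rlIntegral_congr_ae β (Lp.coeFn_add y z) ht
      map_smul' := fun c z ↦ by
        rw [RingHom.id_apply, ← Integrable.toL1_smul', Integrable.toL1_eq_toL1_iff]
        filter_upwards [ae_restrict_mem measurableSet_Icc] with t ht
        rw [rlIntegral_congr_ae β (Lp.coeFn_smul c z) ht, rlIntegral_smul] }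
    (exp T) (norm_toL1_rlIntegral_le hβ)

theorem coeFn_rlIntegralL1_ae (hβ : 0 < β) (z : ℝ →₁[volume.restrict (Icc 0 T)] E) :
    rlIntegralL1 hβ T z =ᵐ[volume.restrict (Icc 0 T)] rlIntegral β z :=
  Integrable.coeFn_toL1 (integrable_rlIntegral_coeFn hβ z)

theorem exists_one_div_rpow_mul_le (hα : 0 < α) {M : ℝ} (hM : 0 ≤ M) :
    ∃ s : ℝ, 0 < s ∧ (1 / s) ^ α * M ≤ 1 / 2 := by
  refine ⟨(2 * (M + 1)) ^ (1 / α), by positivity, ?_⟩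
  have hpow : (1 / (2 * (M + 1)) ^ (1 / α)) ^ α = 1 / (2 * (M + 1)) := by
    rw [one_div, inv_rpow (by positivity), ← rpow_mul (by positivity), one_div_mul_cancel hα.ne',
      rpow_one, one_div]
  rw [hpow, one_div_mul_eq_div, div_le_div_iff₀ (by positivity) two_pos]
  linarith

theorem isUnit_one_sub_rlIntegralL1_comp [CompleteSpace E] (hα : 0 < α) (T : ℝ) (A : E →L[ℝ] E) :
    IsUnit (1 - rlIntegralL1 hα T ∘L A.compLpL 1 (volume.restrict (Icc 0 T))) := by
  obtain ⟨s, hs, hsA⟩ := exists_one_div_rpow_mul_le hα (norm_nonneg A)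
  refine isUnit_one_sub_of_equivalent_contraction (N := fun z ↦ bieleckiNorm s T z)
    (exp_pos (-(s * T))) one_half_pos.le one_half_lt_one (exp_mul_norm_le_bieleckiNorm hs.le)
    (bieleckiNorm_le_norm hs.le) fun z ↦ ?_
  calc bieleckiNorm s T (rlIntegralL1 hα T (A.compLpL 1 _ z))
      = bieleckiNorm s T (rlIntegral α (A.compLpL 1 _ z)) :=
        bieleckiNorm_congr_ae s (coeFn_rlIntegralL1_ae hα _)
    _ ≤ (1 / s) ^ α * bieleckiNorm s T (A.compLpL 1 _ z) :=
        bieleckiNorm_rlIntegral_le hα hs (L1.integrable_coeFn _)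
    _ = (1 / s) ^ α * bieleckiNorm s T (fun t ↦ A (z t)) := by
        rw [bieleckiNorm_congr_ae s (A.coeFn_compLpL z)]
    _ ≤ (1 / s) ^ α * (‖A‖ * bieleckiNorm s T z) := by
        gcongr
        exact bieleckiNorm_comp_le s A (L1.integrable_coeFn z)
    _ ≤ 1 / 2 * bieleckiNorm s T z := by
        rw [← mul_assoc]
        gcongr
        exact integral_nonneg fun t ↦ by positivity

theorem toL1_rlAntideriv (hα : 0 < α) {w : ℝ → E}
    (hw : Integrable w (volume.restrict (Icc 0 T))) (y₀ : E) :
    (integrableOn_rlAntideriv hα hw y₀).integrable.toL1 (rlAntideriv α w y₀) =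
      rlIntegralL1 hα T (hw.toL1 w) +
        (integrableOn_rpow_smul hα ((1 / Gamma α) • y₀)).integrable.toL1 _ := by
  rw [toL1_eq_iff_ae_eq]
  filter_upwards [Lp.coeFn_add (rlIntegralL1 hα T (hw.toL1 w))
      ((integrableOn_rpow_smul hα ((1 / Gamma α) • y₀)).integrable.toL1 _),
    coeFn_rlIntegralL1_ae hα (hw.toL1 w),
    Integrable.coeFn_toL1 (integrableOn_rpow_smul hα ((1 / Gamma α) • y₀)).integrable,
    ae_restrict_mem measurableSet_Icc] with t hadd hI hH ht
  rw [hadd, Pi.add_apply, hI, hH, rlIntegral_congr_ae α hw.coeFn_toL1 ht, rlAntideriv, Pi.add_apply]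

theorem compLpL_toL1 {μ : Measure ℝ} (A : V →L[ℝ] E) {u : ℝ → V} (hu : Integrable u μ) :
    A.compLpL 1 μ (hu.toL1 u) = (A.integrable_comp hu).toL1 fun t ↦ A (u t) := by
  rw [eq_comm, toL1_eq_iff_ae_eq]
  filter_upwards [A.coeFn_compLpL (hu.toL1 u), hu.coeFn_toL1] with t hA hut
  rw [hA, hut]

variable [CompleteSpace E]

theorem exists_solutionMap (hα₀ : 0 < α) (hα₁ : α < 1) (hT : 0 < T) (A : E →L[ℝ] E)
    (B : V →L[ℝ] E) (x₀ : E) :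
    ∃ S : (ℝ →₁[volume.restrict (Icc 0 T)] V) →ᴬ[ℝ] (ℝ →₁[volume.restrict (Icc 0 T)] E),
      ∀ (x : ℝ → E) (u : ℝ → V) (hu : Integrable u (volume.restrict (Icc 0 T))),
        HasRLDerivWithInit α T x (fun t ↦ A (x t) + B (u t)) x₀ ↔
          x =ᵐ[volume.restrict (Icc 0 T)] S (hu.toL1 u) := by
  set μ := volume.restrict (Icc 0 T)
  let I : (ℝ →₁[μ] E) →L[ℝ] (ℝ →₁[μ] E) := rlIntegralL1 hα₀ T
  let H : ℝ →₁[μ] E := (integrableOn_rpow_smul hα₀ ((1 / Gamma α) • x₀)).integrable.toL1 _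
  obtain ⟨R, hR⟩ := isUnit_one_sub_rlIntegralL1_comp hα₀ T A
  refine ⟨(↑R⁻¹ : (ℝ →₁[μ] E) →L[ℝ] (ℝ →₁[μ] E)).toContinuousAffineMap.comp
    ((I ∘L B.compLpL 1 μ).toContinuousAffineMap + .const ℝ _ H), fun x u hu ↦ ?_⟩
  suffices h : Integrable x μ → (HasRLDerivWithInit α T x (fun t ↦ A (x t) + B (u t)) x₀ ↔
      x =ᵐ[μ] (↑R⁻¹ : (ℝ →₁[μ] E) →L[ℝ] (ℝ →₁[μ] E)) (I (B.compLpL 1 μ (hu.toL1 u)) + H)) from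
    ⟨fun hx ↦ (h hx.1).1 hx, fun hx ↦ (h ((L1.integrable_coeFn _).congr hx.symm)).2 hx⟩
  intro hx
  have hw : Integrable (fun t ↦ A (x t) + B (u t)) μ :=
    (A.integrable_comp hx).add (B.integrable_comp hu)
  have hw_toL1 : hw.toL1 _ = A.compLpL 1 μ (hx.toL1 x) + B.compLpL 1 μ (hu.toL1 u) := by
    rw [compLpL_toL1, compLpL_toL1, ← Integrable.toL1_add]
    rfl
  calc HasRLDerivWithInit α T x (fun t ↦ A (x t) + B (u t)) x₀
      ↔ hx.toL1 x = I (hw.toL1 _) + H := by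
        rw [hasRLDerivWithInit_iff_ae_eq_rlAntideriv hα₀ hα₁ hT hw,
          ← toL1_rlAntideriv hα₀ hw x₀, Integrable.toL1_eq_toL1_iff]
    _ ↔ (R : (ℝ →₁[μ] E) →L[ℝ] (ℝ →₁[μ] E)) (hx.toL1 x) = I (B.compLpL 1 μ (hu.toL1 u)) + H := by
        rw [hR, hw_toL1, map_add, add_assoc, ← sub_eq_iff_eq_add']
        rfl
    _ ↔ hx.toL1 x = (↑R⁻¹ : (ℝ →₁[μ] E) →L[ℝ] (ℝ →₁[μ] E)) _ :=
        (ContinuousLinearEquiv.ofUnit R).eq_symm_apply.symm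
    _ ↔ _ := toL1_eq_iff_ae_eq hx

end Volterra

section OptimalControl

theorem exists_ae_eq_forall_mem {Ω V : Type*} [MeasurableSpace Ω] {μ : Measure Ω} {U : Set V}
    {u : Ω → V} (hU : U.Nonempty) (h : ∀ᵐ a ∂μ, u a ∈ U) : ∃ v, v =ᵐ[μ] u ∧ ∀ a, v a ∈ U := by
  classical
  obtain ⟨w, hw⟩ := hU
  refine ⟨fun a ↦ if u a ∈ U then u a else w, ?_, fun a ↦ ?_⟩
  · filter_upwards [h] with a ha using if_pos ha
  · dsimp only
    split_ifs with ha
    exacts [ha, hw]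

variable {E V : Type*} [NormedAddCommGroup E] [NormedSpace ℝ E] [NormedAddCommGroup V]
  [NormedSpace ℝ V] {α p T : ℝ} {A : E →L[ℝ] E} {B : V →L[ℝ] E} {U : Set V} {x₀ : E}
  {x : ℝ → E} {u : ℝ → V}

/-- `u` is an integrable control on `[0, T]` with values in `U`, and `x` is a trajectory of the
linear fractional control system `D^α[x] = A x + B u`, `I^{1-α}[x](0) = x₀`. -/
def IsAdmissiblePair (α T : ℝ) (A : E →L[ℝ] E) (B : V →L[ℝ] E) (U : Set V) (x₀ : E)
    (x : ℝ → E) (u : ℝ → V) : Prop :=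
  (IntegrableOn u (Icc 0 T) ∧ ∀ t ∈ Icc 0 T, u t ∈ U) ∧
    HasRLDerivWithInit α T x (fun t ↦ A (x t) + B (u t)) x₀

theorem IsAdmissiblePair.memRLSpace [CompleteSpace E] (hα₀ : 0 < α) (hα₁ : α < 1) (hT : 0 < T)
    (hp : 1 ≤ p) (hpα : p * (1 - α) < 1) (h : IsAdmissiblePair α T A B U x₀ x u)
    (hu : MemLp u (ENNReal.ofReal p) (volume.restrict (Icc 0 T))) : MemRLSpace α p T x := by
  have hv : IntegrableOn (fun t ↦ A (x t) + B (u t)) (Icc 0 T) :=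
    (A.integrable_comp h.2.1).add (B.integrable_comp h.1.1)
  have hx := (hasRLDerivWithInit_iff_ae_eq_rlAntideriv hα₀ hα₁ hT hv).1 h.2
  refine ⟨fun t ↦ A (x t) + B (u t), (A.comp_memLp' ?_).add (B.comp_memLp' hu),
    (1 / Gamma α) • x₀, ?_⟩
  · exact (memLp_congr_ae hx).2 (memLp_rlAntideriv hα₀ hp hpα hv x₀)
  · filter_upwards [hx, ae_restrict_mem measurableSet_Icc] with t hxt ht
    rw [hxt, rlAntideriv, Pi.add_apply, one_div (t ^ _), ← rpow_neg ht.1, neg_sub]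

theorem exists_isAdmissiblePair_forall_lintegral_le [CompleteSpace E] [CompleteSpace V]
    (hα₀ : 0 < α) (hα₁ : α < 1) (hT : 0 < T) (A : E →L[ℝ] E) (B : V →L[ℝ] E)
    (hU : Convex ℝ U) (hU_closed : IsClosed U) (hU_nonempty : U.Nonempty) (x₀ : E)
    {L : E × V → ℝ≥0∞} (hL : LowerSemicontinuous L) {κ : ℝ≥0∞} (hκ : κ ≠ 0)
    (hL_mid : ∀ y z, 2 * L (midpoint ℝ y z) + κ * ‖y.2 - z.2‖ₑ ^ 2 ≤ L y + L z) :
    ∃ x u, IsAdmissiblePair α T A B U x₀ x u ∧ ∀ y v, IsAdmissiblePair α T A B U x₀ y v →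
      ∫⁻ t in Icc 0 T, L (x t, u t) ≤ ∫⁻ t in Icc 0 T, L (y t, v t) := by
  obtain ⟨S, hS⟩ := exists_solutionMap hα₀ hα₁ hT A B x₀
  obtain ⟨w, hwU, hw_min⟩ :=
    exists_isMinOn_lintegral_comp_affine hU hU_closed hU_nonempty S hL hκ hL_mid
  obtain ⟨u, huw, huU⟩ := exists_ae_eq_forall_mem hU_nonempty hwU
  have hu := (L1.integrable_coeFn w).congr huw.symm
  have hu_toL1 : hu.toL1 u = w := (toL1_eq_iff_ae_eq hu).2 huw
  refine ⟨S w, u, ⟨⟨hu, fun t _ ↦ huU t⟩, (hS _ u hu).2 (by rw [hu_toL1])⟩,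
    fun y v ⟨⟨hv, hvU⟩, hy⟩ ↦ ?_⟩
  have hv_toL1 := hv.integrable.coeFn_toL1
  calc ∫⁻ t in Icc 0 T, L (S w t, u t)
      = ∫⁻ t in Icc 0 T, L (S w t, w t) :=
        lintegral_congr_ae (by filter_upwards [huw] with t ht; rw [ht])
    _ ≤ ∫⁻ t in Icc 0 T, L (S (hv.integrable.toL1 v) t, hv.integrable.toL1 v t) := by
        refine hw_min ?_
        filter_upwards [hv_toL1, ae_restrict_mem measurableSet_Icc] with t hvt ht
        rw [hvt]
        exact hvU t ht
    _ = ∫⁻ t in Icc 0 T, L (y t, v t) := by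
        refine lintegral_congr_ae ?_
        filter_upwards [hv_toL1, (hS y v hv.integrable).1 hy] with t hvt hyt
        rw [hvt, hyt]

end OptimalControl

theorem two_mul_norm_midpoint_sq_add {V : Type*} [NormedAddCommGroup V] [InnerProductSpace ℝ V]
    (p q : V) : 2 * ‖midpoint ℝ p q‖ ^ 2 + 1 / 2 * ‖p - q‖ ^ 2 = ‖p‖ ^ 2 + ‖q‖ ^ 2 := by
  have h := parallelogram_law_with_norm ℝ p q
  rw [midpoint_eq_smul_add, norm_smul, norm_of_nonneg (by norm_num), invOf_eq_inv]
  linear_combination 1 / 2 * h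

theorem two_mul_norm_midpoint_sq_le {V : Type*} [NormedAddCommGroup V] [InnerProductSpace ℝ V]
    (p q : V) : 2 * ‖midpoint ℝ p q‖ ^ 2 ≤ ‖p‖ ^ 2 + ‖q‖ ^ 2 := by
  rw [← two_mul_norm_midpoint_sq_add]
  exact le_add_of_nonneg_right (by positivity)

namespace HegselmannKrause

variable {N d : ℕ} {α p K T ν : ℝ} {a : Fin N → Fin N → ℝ} {c : Fin N → ℝ} {x₀ : State N d}
  {x : ℝ → State N d} {u : ℝ → EuclideanSpace ℝ (Fin d)}

/-- The linear map `x ↦ field a c x 0`: the dynamics of the agents when the leader is at rest. -/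
noncomputable def drift (a : Fin N → Fin N → ℝ) (c : Fin N → ℝ) : State N d →L[ℝ] State N d :=
  LinearMap.toContinuousLinearMap
    { toFun := fun x ↦ field a c x 0
      map_add' := fun x y ↦ by
        ext i : 1
        refine Fin.cases ?_ (fun i ↦ ?_) i
        · simp [field]
        · simp only [field, Fin.cons_succ, Pi.add_apply, add_sub_add_comm, smul_add,
            Finset.sum_add_distrib]
          abel
      map_smul' := fun r x ↦ by
        ext i : 1
        refine Fin.cases ?_ (fun i ↦ ?_) i
        · simp [field]
        · simp only [field, Fin.cons_succ, Pi.smul_apply, ← smul_sub, smul_comm _ r,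
            ← Finset.smul_sum, RingHom.id_apply, smul_add] }

theorem field_eq_drift_add_single (a : Fin N → Fin N → ℝ) (c : Fin N → ℝ) (x : State N d)
    (u : EuclideanSpace ℝ (Fin d)) :
    field a c x u = drift a c x +
      ContinuousLinearMap.single ℝ (fun _ : Fin (N + 1) ↦ EuclideanSpace ℝ (Fin d)) 0 u := by
  ext i : 1
  refine Fin.cases ?_ (fun i ↦ ?_) i <;> simp [drift, field]

theorem isAdmissible_iff_isAdmissiblePair :
    IsAdmissible α K T a c x₀ x u ↔ IsAdmissiblePair α T (drift a c)
      (ContinuousLinearMap.single ℝ (fun _ : Fin (N + 1) ↦ EuclideanSpace ℝ (Fin d)) 0)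
      (Metric.closedBall 0 K) x₀ x u := by
  simp only [IsAdmissible, IsAdmissiblePair, controls, field_eq_drift_add_single, mem_ofPred_eq,
    mem_closedBall_zero_iff]

theorem IsAdmissible.memRLSpace (hα₀ : 0 < α) (hα₁ : α < 1) (hT : 0 < T) (hp : 1 ≤ p)
    (hpα : p * (1 - α) < 1) (h : IsAdmissible α K T a c x₀ x u) : MemRLSpace α p T x := by
  refine (isAdmissible_iff_isAdmissiblePair.1 h).memRLSpace hα₀ hα₁ hT hp hpα
    (.of_bound h.1.1.aestronglyMeasurable K ?_)
  filter_upwards [ae_restrict_mem measurableSet_Icc] with t ht using h.1.2 t ht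

theorem runningCost_nonneg (hν : 0 ≤ ν) (x : State N d) (u : EuclideanSpace ℝ (Fin d)) :
    0 ≤ runningCost ν x u := by
  unfold runningCost
  positivity

theorem continuous_runningCost (ν : ℝ) :
    Continuous fun z : State N d × EuclideanSpace ℝ (Fin d) ↦ runningCost ν z.1 z.2 := by
  unfold runningCost
  fun_prop

theorem two_mul_runningCost_midpoint_add_le (x y : State N d) (u v : EuclideanSpace ℝ (Fin d)) :
    2 * runningCost ν (midpoint ℝ x y) (midpoint ℝ u v) + ν / 4 * ‖u - v‖ ^ 2 ≤
      runningCost ν x u + runningCost ν y v := by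
  have hpair : ∀ i j : Fin (N + 1), 2 * ‖midpoint ℝ x y i - midpoint ℝ x y j‖ ^ 2 ≤
      ‖x i - x j‖ ^ 2 + ‖y i - y j‖ ^ 2 := fun i j ↦ by
    rw [pi_midpoint_apply, pi_midpoint_apply, ← vsub_eq_sub, midpoint_vsub_midpoint]
    exact two_mul_norm_midpoint_sq_le _ _
  have hagents := mul_le_mul_of_nonneg_left
    (Finset.sum_le_sum fun (i : Fin N) (_ : i ∈ Finset.univ) ↦
      Finset.sum_le_sum fun (j : Fin N) (_ : j ∈ Finset.univ) ↦ hpair i.succ j.succ)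
    (show 0 ≤ 1 / (2 * (N : ℝ) ^ 2) by positivity)
  have hleader := Finset.sum_le_sum fun (i : Fin N) (_ : i ∈ Finset.univ) ↦ hpair 0 i.succ
  have hcontrol := two_mul_norm_midpoint_sq_add u v
  simp only [Finset.sum_add_distrib, ← Finset.mul_sum] at hagents hleader
  unfold runningCost
  linear_combination hagents + 1 / 2 * hleader + ν / 2 * hcontrol

theorem two_mul_ofReal_runningCost_midpoint_add_le (hν : 0 ≤ ν)
    (y z : State N d × EuclideanSpace ℝ (Fin d)) :
    2 * ENNReal.ofReal (runningCost ν (midpoint ℝ y z).1 (midpoint ℝ y z).2) +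
        ENNReal.ofReal (ν / 4) * ‖y.2 - z.2‖ₑ ^ 2 ≤
      ENNReal.ofReal (runningCost ν y.1 y.2) + ENNReal.ofReal (runningCost ν z.1 z.2) := by
  have hmid := runningCost_nonneg hν (midpoint ℝ y z).1 (midpoint ℝ y z).2
  rw [← ENNReal.ofReal_add (runningCost_nonneg hν _ _) (runningCost_nonneg hν _ _),
    ← ofReal_norm, ← ENNReal.ofReal_pow (norm_nonneg _), ← ENNReal.ofReal_mul (by positivity),
    two_mul, ← ENNReal.ofReal_add hmid hmid, ← two_mul,
    ← ENNReal.ofReal_add (by positivity) (by positivity)]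
  exact ENNReal.ofReal_le_ofReal (two_mul_runningCost_midpoint_add_le _ _ _ _)

theorem exists_isAdmissible_forall_cost_le (hα₀ : 0 < α) (hα₁ : α < 1) (hT : 0 < T) (hK : 0 ≤ K)
    (hν : 0 < ν) (a : Fin N → Fin N → ℝ) (c : Fin N → ℝ) (x₀ : State N d) :
    ∃ x u, IsAdmissible α K T a c x₀ x u ∧
      ∀ y v, IsAdmissible α K T a c x₀ y v → cost ν T x u ≤ cost ν T y v := by
  simp only [isAdmissible_iff_isAdmissiblePair]
  exact exists_isAdmissiblePair_forall_lintegral_le hα₀ hα₁ hT _ _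
    (convex_closedBall 0 K) Metric.isClosed_closedBall (Metric.nonempty_closedBall.2 hK) x₀
    (ENNReal.continuous_ofReal.comp (continuous_runningCost ν)).lowerSemicontinuous
    (ENNReal.ofReal_pos.2 (by positivity)).ne'
    (two_mul_ofReal_runningCost_midpoint_add_le hν.le)

end HegselmannKrause

theorem mainTheorem1_general {N d : ℕ} (α p T K ν : ℝ) (hα₀ : 0 < α) (hα₁ : α < 1) (hp : 1 ≤ p)
    (hpα : p < 1 / (1 - α)) (hT : 0 < T) (hK : 0 ≤ K) (hν : 0 < ν) (a : Fin N → Fin N → ℝ)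
    (c : Fin N → ℝ) (x₀ : HegselmannKrause.State N d) :
    ∃ (x : ℝ → HegselmannKrause.State N d) (u : ℝ → EuclideanSpace ℝ (Fin d)),
      MemRLSpace α p T x ∧
      HegselmannKrause.IsAdmissible α K T a c x₀ x u ∧
      ∀ (y : ℝ → HegselmannKrause.State N d) (v : ℝ → EuclideanSpace ℝ (Fin d)),
        HegselmannKrause.IsAdmissible α K T a c x₀ y v →
          HegselmannKrause.cost ν T x u ≤ HegselmannKrause.cost ν T y v := by
  obtain ⟨x, u, hxu, hmin⟩ := HegselmannKrause.exists_isAdmissible_forall_cost_le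
    hα₀ hα₁ hT hK hν a c x₀
  rw [lt_div_iff₀ (sub_pos.2 hα₁)] at hpα
  exact ⟨x, u, hxu.memRLSpace hα₀ hα₁ hT hp hpα, hxu, hmin⟩

theorem mainTheorem1 (N d : ℕ) (hN : 1 < N) (hd : 1 ≤ d)
    (α p T K ν : ℝ) (hα₀ : 0 < α) (hα₁ : α < 1) (hp : 1 < p) (hpα : p < 1 / (1 - α))
    (hT : 0 < T) (hK : 0 ≤ K) (hν : 0 < ν)
    (a : Fin N → Fin N → ℝ) (ha : ∀ i j, 0 ≤ a i j) (c : Fin N → ℝ) (hc : ∀ i, 0 ≤ c i)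
    (x₀ : HegselmannKrause.State N d) :
    ∃ (x : ℝ → HegselmannKrause.State N d) (u : ℝ → EuclideanSpace ℝ (Fin d)),
      MemRLSpace α p T x ∧
      HegselmannKrause.IsAdmissible α K T a c x₀ x u ∧
      ∀ (y : ℝ → HegselmannKrause.State N d) (v : ℝ → EuclideanSpace ℝ (Fin d)),
        HegselmannKrause.IsAdmissible α K T a c x₀ y v →
          HegselmannKrause.cost ν T x u ≤ HegselmannKrause.cost ν T y v :=
  mainTheorem1_general α p T K ν hα₀ hα₁ hp.le hpα hT hK hν a c x₀
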